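/- Let $(\Omega,\mathcal F,\mathbb P)$ be an atomless probability space (i.e. it carries a random variable with continuous cumulative distribution function), let $L^\infty$ and $L^1$ be the spaces of bounded, respectively integrable, random variables modulo $\mathbb P$-a.s. equality, and let $n\ge 2$. Definitions. Let $\mathbb Q\ll\mathbb P$ be a probability measure. A map $\rho\colon L^\infty\to\mathbb R$ is a $\mathbb Q$-consistent risk measure if it is monotone ($X\le Y$ implies $\rho(X)\le\rho(Y)$), cash-additive ($\rho(X+m)=\rho(X)+m$ for $m\in\mathbb R$), normalised ($\rho(0)=0$), and if $\rho(X)\le\rho(Y)$ whenever $\mathbb E_{\mathbb Q}[v(X)]\le\mathbb E_{\mathbb Q}[v(Y)]$ holds for all convex nondecreasing $v\colon\mathbb R\to\mathbb R$. Its acceptance set is $\mathcal A_\rho=\{X\in L^\infty: \rho(X)\le 0\}$, with asymptotic cone $$\mathcal A_\rho^\infty=\{U\in L^\infty: \exists\,(s_k)\subset(0,\infty),\ (Y_k)\subset\mathcal A_\rho \text{ with } s_k\to 0 \text{ and } \|s_kY_k-U\|_\infty\to 0\}.$$ For $Z\in L^1$ put $\rho^*(Z)=\sup_{X\in L^\infty}(\mathbb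 E[ZX]-\rho(X))\in(-\infty,\infty]$. Let $\mathbf C(\rho)$ be the set of all $Z\in L^1$ such that $\rho^*(Z)<\infty$ and such that every $U\in\mathcal A_\rho^\infty$ with $\mathbb E[ZU]=0$ satisfies $U=0$; its elements are called compatible, and $\rho$ is called admissible if $\mathbf C(\rho)\ne\emptyset$. Theorem. Suppose: (i) $\mathbb Q_1,\dots,\mathbb Q_n$ are probability measures on $(\Omega,\mathcal F)$ equivalent to $\mathbb P$, and each density $d\mathbb Q_i/d\mathbb P$ has a version which is a simple function; (ii) for each $i\in\{1,\dots,n\}$, $\rho_i\colon L^\infty\to\mathbb R$ is a $\mathbb Q_i$-consistent risk measure; (iii) $\rho_1,\dots,\rho_{n-1}$ are admissible, and for each $i\in\{1,\dots,n-1\}$ there is $Z_i\in\mathbf C(\rho_i)$ with $\max_{1\le k\le n}\rho_k^*(Z_i)<\infty$. Then for every $X\in L^\infty$ there is an optimal (Pareto-optimal) allocation, i.e. there are $X_1,\dots,X_n\in L^\infty$ with $X_1+\dots+X_n=X$ and $$\sum_{i=1}^n\rho_i(X_i)=\inf\Big\{\sum_{i=1}^n\rho_i(Y_i): Y_1,\dots,Y_n\in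 L^\infty,\ Y_1+\dots+Y_n=X\Big\}.$$ In particular, this infimum (the infimal convolution of $\rho_1,\dots,\rho_n$ at $X$) is finite. -/

import Mathlib

open MeasureTheory Filter Topology
open scoped ENNReal

noncomputable section

namespace RiskSharing

variable {Ω : Type*} [MeasurableSpace Ω]

/-- `(Ω, P)` is atomless: some random variable has a continuous cumulative distribution
function under `P`. -/
def IsAtomless (P : Measure Ω) : Prop :=
  ∃ U : Ω → ℝ, Measurable U ∧ Continuous fun x => ProbabilityTheory.cdf (P.map U) x

/-- Equivalence of measures (the same null sets). -/
def EquivMeasure (Q P : Measure Ω) : Prop := Q ≪ P ∧ P ≪ Q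

/-- The density `dQ/dP` has a version which is a simple function. -/
def HasSimpleDensity (P Q : Measure Ω) : Prop :=
  ∃ f : SimpleFunc Ω ℝ, (fun ω => (Q.rnDeriv P ω).toReal) =ᵐ[P] f

/-- The space `L^∞` of `P`-essentially bounded random variables modulo `P`-a.s. equality, with
the essential supremum norm and the `P`-a.s. order. -/
abbrev LInf (P : Measure Ω) := Lp ℝ ∞ P

/-- The space `L^1` of `P`-integrable random variables modulo `P`-a.s. equality. -/
abbrev LOne (P : Measure Ω) := Lp ℝ 1 P

/-- `Y` dominates `X` in second-order stochastic dominance under `Q`: `E_Q[v(X)] ≤ E_Q[v(Y)]` for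
all convex nondecreasing `v : ℝ → ℝ`. It is used for `Q ≪ P` only: then `X` and `Y` are
`Q`-essentially bounded, so that both integrands are `Q`-integrable, and the choice of
representatives is immaterial. -/
def SSDominates {P : Measure Ω} (Q : Measure Ω) (Y X : LInf P) : Prop :=
  ∀ v : ℝ → ℝ, ConvexOn ℝ Set.univ v → Monotone v → ∫ ω, v (X ω) ∂Q ≤ ∫ ω, v (Y ω) ∂Q

/-- Monetary risk measures: monotone and cash-additive functionals on `L^∞`. -/
structure IsMonetary {P : Measure Ω} [IsProbabilityMeasure P] (ρ : LInf P → ℝ) : Prop where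
  monotone : ∀ X Y : LInf P, X ≤ Y → ρ X ≤ ρ Y
  cash_additive : ∀ (X : LInf P) (m : ℝ), ρ (X + Lp.const ∞ P m) = ρ X + m

/-- `Q`-consistent risk measures: normalised monetary risk measures which respect second-order
stochastic dominance under `Q`. -/
structure IsConsistent {P : Measure Ω} [IsProbabilityMeasure P] (Q : Measure Ω)
    (ρ : LInf P → ℝ) : Prop extends IsMonetary ρ where
  normalised : ρ 0 = 0
  consistent : ∀ X Y : LInf P, SSDominates Q Y X → ρ X ≤ ρ Y

/-- The acceptance set `{X ∈ L^∞ : ρ(X) ≤ 0}`. -/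
def acceptanceSet {P : Measure Ω} (ρ : LInf P → ℝ) : Set (LInf P) := {X | ρ X ≤ 0}

/-- The asymptotic cone of the acceptance set: all norm limits `lim s_k Y_k` with `s_k > 0`,
`s_k → 0` and `Y_k` acceptable. -/
def asymptoticCone {P : Measure Ω} (ρ : LInf P → ℝ) : Set (LInf P) :=
  {U | ∃ (s : ℕ → ℝ) (Y : ℕ → LInf P), (∀ k, 0 < s k) ∧ (∀ k, Y k ∈ acceptanceSet ρ) ∧
    Tendsto s atTop (𝓝 0) ∧ Tendsto (fun k => s k • Y k) atTop (𝓝 U)}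

/-- The convex conjugate `ρ^*(φ) = sup {φ(X) - ρ(X) : X ∈ L^∞}` on the dual of `L^∞`. -/
def conjugate {P : Measure Ω} (ρ : LInf P → ℝ) (φ : StrongDual ℝ (LInf P)) : EReal :=
  ⨆ X : LInf P, ((φ X - ρ X : ℝ) : EReal)

/-- The bounded linear functional `X ↦ E[ZX]` on `L^∞` defined by `Z ∈ L^1`. -/
def toDual {P : Measure Ω} (Z : LOne P) : StrongDual ℝ (LInf P) :=
  (ContinuousLinearMap.mul ℝ ℝ).lpPairing P 1 ∞ Z

theorem toDual_apply {P : Measure Ω} (Z : LOne P) (X : LInf P) :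
    toDual Z X = ∫ ω, Z ω * X ω ∂P := by
  simp [toDual, ContinuousLinearMap.lpPairing_eq_integral]

/-- The set of elements `Z ∈ L^1` compatible with `ρ`: `ρ^*(Z) < ∞`, and `U = 0` is the only
element `U` of the asymptotic cone with `E[ZU] = 0`. -/
def compatibleSet {P : Measure Ω} (ρ : LInf P → ℝ) : Set (LOne P) :=
  {Z | conjugate ρ (toDual Z) < ⊤ ∧
    ∀ U ∈ asymptoticCone ρ, ∫ ω, Z ω * U ω ∂P = 0 → U = 0}

/-- `ρ` is admissible if it has a compatible element. -/
def IsAdmissible {P : Measure Ω} (ρ : LInf P → ℝ) : Prop := (compatibleSet ρ).Nonempty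

/-- The allocations of `X` among `n` agents. -/
def allocations {P : Measure Ω} (n : ℕ) (X : LInf P) : Set (Fin n → LInf P) :=
  {Y | ∑ i, Y i = X}

/-- The infimal convolution of `ρ_1, …, ρ_n`, with values in the extended reals. -/
def infConvolution {P : Measure Ω} {n : ℕ} (ρ : Fin n → LInf P → ℝ) (X : LInf P) : EReal :=
  ⨅ Y ∈ allocations n X, ((∑ i, ρ i (Y i) : ℝ) : EReal)

/-- The allocation `Y` of `X` is optimal: its aggregated risk attains the infimal convolution. -/
def IsOptimalAllocation {P : Measure Ω} {n : ℕ} (ρ : Fin n → LInf P → ℝ) (X : LInf P)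
    (Y : Fin n → LInf P) : Prop :=
  Y ∈ allocations n X ∧ infConvolution ρ X = ((∑ i, ρ i (Y i) : ℝ) : EReal)

end RiskSharing

end

/-!
The argument reduces the problem to allocations which are comonotone on the cells of a finite
partition, and then uses compactness.

Since the densities `dQ i/dP` are simple, there is a finite partition, encoded by a map `κ`, such
that on each cell every `Q i` is a multiple of `P` (`exists_partition_of_hasSimpleDensity`). Given
an allocation `W` of `X`, consider all allocations `y` of `X` such that `W i` dominates `y i` in
second-order stochastic dominance under `Q i` for all `i`. They form a closed convex subset of a
power of `L²`, which has an element of minimal norm. That element is comonotone on each cell: if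
two agents held components moving in opposite directions on two sets of positive measure in the
same cell, a small mean-preserving exchange between them would lower both components in convex
order and strictly decrease the norm (`measure_eq_zero_of_minimal`). Comonotone components have
increments bounded by those of `X`, so they are `1`-Lipschitz functions of `X` on each cell. By
consistency, this improves `W` for every agent (`exists_locallyLipschitz_improvement`).

By the theorem of Arzelà and Ascoli, bounded sets of such functions are relatively compact in `L^∞`
(`exists_isCompact_locallyLipschitzSet`). Take a minimising sequence of improved allocations, and
subtract cash such that each component has risk zero. If the sequence were unbounded, its
normalisations would have a nonzero cluster point `U` with `U i` in the asymptotic cone of agent `i`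
and `∑ i, U i = 0`. The densities `Z i` of the compatibility hypothesis satisfy `E[Z i * U k] ≤ 0`
for all `k`; these numbers sum to zero, so they vanish, and compatibility yields `U i = 0` for all
agents but the last, hence for the last as well (`eq_zero_of_sum_eq_zero`). So the sequence is
bounded (`exists_norm_le_of_acceptable`) and has a convergent subsequence. As monetary risk
measures are continuous, its limit, with the cash restored, is optimal.
-/

namespace RiskSharing

/-! ### Mean-preserving contractions -/

/-- A convex function on the line has a slope `p` at `m` such that moving a point towards `m`,
without crossing it, changes the value by at most `p` times the displacement. -/
theorem exists_slope_of_convexOn {v : ℝ → ℝ} (hv : ConvexOn ℝ Set.univ v) (m : ℝ) :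
    ∃ p : ℝ, ∀ y e : ℝ, (e = 0 ∨ (m ≤ y + e ∧ e ≤ 0) ∨ (0 ≤ e ∧ y + e ≤ m)) →
      v (y + e) ≤ v y + p * e := by
  refine ⟨derivWithin v (Set.Ioi m) m, fun y e h => ?_⟩
  have hm : m ∈ interior (Set.univ : Set ℝ) := by simp
  rcases eq_or_ne e 0 with rfl | he
  · simp
  rcases h with h | ⟨h1, h2⟩ | ⟨h1, h2⟩
  · exact absurd h he
  · have he' : e < 0 := lt_of_le_of_ne h2 he
    have h3 := hv.rightDeriv_le_slope_of_mem_interior hm (Set.mem_univ y) (by linarith : m < y)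
    have h4 : slope v m y ≤ slope v (y + e) y := by
      rcases h1.eq_or_lt with h | h
      · rw [h]
      · rw [slope_comm v m y, slope_comm v (y + e) y]
        exact hv.slope_mono (Set.mem_univ y) ⟨Set.mem_univ _, by simp; linarith⟩
          ⟨Set.mem_univ _, by simpa using he⟩ h1
    have h5 := h3.trans h4
    rw [slope_def_field, le_div_iff₀ (by linarith)] at h5
    linarith
  · have he' : 0 < e := lt_of_le_of_ne h1 (Ne.symm he)
    have h3 := (hv.slope_le_leftDeriv_of_mem_interior (Set.mem_univ y) hm
      (by linarith : y < m)).trans (hv.leftDeriv_le_rightDeriv_of_mem_interior hm)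
    have h4 : slope v y (y + e) ≤ slope v y m := by
      exact hv.slope_mono (Set.mem_univ y) ⟨Set.mem_univ _, by simpa using he⟩
          ⟨Set.mem_univ _, by simp; linarith⟩ h2
    have h5 := h4.trans h3
    rw [slope_def_field, div_le_iff₀ (by linarith)] at h5
    linarith

theorem continuous_of_convexOn {v : ℝ → ℝ} (hv : ConvexOn ℝ Set.univ v) : Continuous v :=
  continuousOn_univ.1 (hv.continuousOn isOpen_univ)

variable {Ω : Type*} [MeasurableSpace Ω]

theorem exists_bound_comp {v : ℝ → ℝ} (hv : Continuous v) (R : ℝ) :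
    ∃ C, ∀ y, |y| ≤ R → ‖v y‖ ≤ C := by
  obtain ⟨C, hC⟩ := (isCompact_Icc (a := -R) (b := R)).exists_bound_of_continuousOn hv.continuousOn
  exact ⟨C, fun y hy => hC y (abs_le.1 hy)⟩

theorem integrable_comp_of_bounded {Q : Measure Ω} [IsFiniteMeasure Q] {v : ℝ → ℝ}
    (hv : Continuous v) {f : Ω → ℝ} (hf : AEStronglyMeasurable f Q) {R : ℝ}
    (hR : ∀ᵐ ω ∂Q, |f ω| ≤ R) : Integrable (fun ω => v (f ω)) Q := by
  obtain ⟨C, hC⟩ := exists_bound_comp hv R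
  exact Integrable.of_bound (hv.comp_aestronglyMeasurable hf) C (hR.mono fun ω h => hC _ h)

/-- Perturbations of mean zero which move the values of `f` towards a level `m`, without crossing
it, decrease `f` in convex order. -/
theorem integral_comp_add_le {Q : Measure Ω} [IsFiniteMeasure Q] {v : ℝ → ℝ}
    (hv : ConvexOn ℝ Set.univ v) {f e : Ω → ℝ} (hf : AEStronglyMeasurable f Q)
    (he : Integrable e Q) {R : ℝ} (hR : ∀ᵐ ω ∂Q, |f ω| ≤ R) (hR' : ∀ᵐ ω ∂Q, |f ω + e ω| ≤ R)
    {m : ℝ} (hm : ∀ᵐ ω ∂Q, e ω = 0 ∨ (m ≤ f ω + e ω ∧ e ω ≤ 0) ∨ (0 ≤ e ω ∧ f ω + e ω ≤ m))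
    (h0 : ∫ ω, e ω ∂Q = 0) :
    ∫ ω, v (f ω + e ω) ∂Q ≤ ∫ ω, v (f ω) ∂Q := by
  obtain ⟨p, hp⟩ := exists_slope_of_convexOn hv m
  have hvc := continuous_of_convexOn hv
  have h1 := integrable_comp_of_bounded hvc hf hR
  have h2 := integrable_comp_of_bounded hvc (hf.add he.aestronglyMeasurable) hR'
  calc ∫ ω, v (f ω + e ω) ∂Q ≤ ∫ ω, (v (f ω) + p * e ω) ∂Q :=
        integral_mono_ae h2 (h1.add (he.const_mul p)) (hm.mono fun ω h => hp _ _ h)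
    _ = ∫ ω, v (f ω) ∂Q := by
        rw [integral_add h1 (he.const_mul p), integral_const_mul, h0, mul_zero, add_zero]

/-- The square-integrable random variables bounded by `R` which are dominated by `g` in
second-order stochastic dominance under `Q`. By the bound, `v ∘ f` is bounded for every convex
`v`, so that the integrals are not junk values and dominated convergence applies. -/
def dominatedSet (P Q : Measure Ω) (R : ℝ) (g : Ω → ℝ) : Set (Lp ℝ 2 P) :=
  {f | (∀ᵐ ω ∂P, |f ω| ≤ R) ∧ ∀ v : ℝ → ℝ, ConvexOn ℝ Set.univ v → Monotone v →
    ∫ ω, v (f ω) ∂Q ≤ ∫ ω, v (g ω) ∂Q}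

theorem convex_dominatedSet {P Q : Measure Ω} [IsFiniteMeasure Q] (hQ : Q ≪ P) (R : ℝ)
    (g : Ω → ℝ) : Convex ℝ (dominatedSet P Q R g) := by
  rintro f₁ ⟨h₁, h₁'⟩ f₂ ⟨h₂, h₂'⟩ a b ha hb hab
  have hae : ∀ᵐ ω ∂P, (a • f₁ + b • f₂ : Lp ℝ 2 P) ω = a * f₁ ω + b * f₂ ω := by
    filter_upwards [Lp.coeFn_add (a • f₁) (b • f₂), Lp.coeFn_smul a f₁, Lp.coeFn_smul b f₂]
      with ω h1 h2 h3
    rw [h1, Pi.add_apply, h2, h3]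
    rfl
  have hbd : ∀ᵐ ω ∂P, |(a • f₁ + b • f₂ : Lp ℝ 2 P) ω| ≤ R := by
    filter_upwards [hae, h₁, h₂] with ω h h1 h2
    rw [h]
    rw [abs_le] at *
    constructor <;> nlinarith
  refine ⟨hbd, fun v hv hmono => ?_⟩
  have hvc := continuous_of_convexOn hv
  have hm : ∀ f : Lp ℝ 2 P, AEStronglyMeasurable f Q := fun f =>
    (Lp.aestronglyMeasurable f).mono_ac hQ
  have i1 := integrable_comp_of_bounded hvc (hm f₁) (hQ.ae_le h₁)
  have i2 := integrable_comp_of_bounded hvc (hm f₂) (hQ.ae_le h₂)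
  have i3 := integrable_comp_of_bounded hvc (hm (a • f₁ + b • f₂)) (hQ.ae_le hbd)
  calc ∫ ω, v ((a • f₁ + b • f₂ : Lp ℝ 2 P) ω) ∂Q
      ≤ ∫ ω, (a * v (f₁ ω) + b * v (f₂ ω)) ∂Q := by
        refine integral_mono_ae i3 ((i1.const_mul a).add (i2.const_mul b)) ?_
        filter_upwards [hQ.ae_le hae] with ω h
        rw [h]
        exact hv.2 (Set.mem_univ _) (Set.mem_univ _) ha hb hab
    _ = a * ∫ ω, v (f₁ ω) ∂Q + b * ∫ ω, v (f₂ ω) ∂Q := by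
        rw [integral_add (i1.const_mul a) (i2.const_mul b), integral_const_mul, integral_const_mul]
    _ ≤ a * ∫ ω, v (g ω) ∂Q + b * ∫ ω, v (g ω) ∂Q :=
        add_le_add (mul_le_mul_of_nonneg_left (h₁' v hv hmono) ha)
          (mul_le_mul_of_nonneg_left (h₂' v hv hmono) hb)
    _ = ∫ ω, v (g ω) ∂Q := by rw [← add_mul, hab, one_mul]

theorem isClosed_dominatedSet {P Q : Measure Ω} [IsFiniteMeasure Q] (hQ : Q ≪ P) (R : ℝ)
    (g : Ω → ℝ) : IsClosed (dominatedSet P Q R g) := by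
  refine IsSeqClosed.isClosed fun u f hu hf => ?_
  obtain ⟨ns, -, hns⟩ := (tendstoInMeasure_of_tendsto_Lp hf).exists_seq_tendsto_ae
  have hbd : ∀ᵐ ω ∂P, ∀ k, |u k ω| ≤ R := ae_all_iff.2 fun k => (hu k).1
  refine ⟨?_, fun v hv hmono => ?_⟩
  · filter_upwards [hns, hbd] with ω h1 h2
    exact le_of_tendsto' h1.abs fun k => h2 _
  have hvc := continuous_of_convexOn hv
  obtain ⟨C, hC⟩ := exists_bound_comp hvc R
  refine le_of_tendsto' (tendsto_integral_of_dominated_convergence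
    (F := fun k ω => v (u (ns k) ω)) (fun _ => C) (fun k => ?_) (integrable_const C)
    (fun k => ?_) ?_) fun k => (hu (ns k)).2 v hv hmono
  · exact hvc.comp_aestronglyMeasurable ((Lp.aestronglyMeasurable _).mono_ac hQ)
  · exact hQ.ae_le (hbd.mono fun ω h => hC _ (h _))
  · exact hQ.ae_le (hns.mono fun ω h => (hvc.tendsto _).comp h)

/-! ### Local comonotone improvement -/

/-- The random variables which, on each cell `{κ = c}`, are given by a `1`-Lipschitz function
of `X`. -/
def locallyLipschitzSet {P : Measure Ω} {J : Type*} (κ : Ω → J) (X : LInf P) : Set (LInf P) :=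
  {Y | ∃ h : J → ℝ → ℝ, (∀ c, LipschitzWith 1 (h c)) ∧ Y =ᵐ[P] fun ω => h (κ ω) (X ω)}

theorem ae_abs_le_norm {P : Measure Ω} (X : LInf P) : ∀ᵐ ω ∂P, |X ω| ≤ ‖X‖ := by
  have h := enorm_ae_le_eLpNormEssSup X P
  filter_upwards [h] with ω hω
  rw [Lp.norm_def, eLpNorm_exponent_top, ← Real.norm_eq_abs, ← toReal_enorm]
  refine ENNReal.toReal_mono ?_ hω
  rw [← eLpNorm_exponent_top]
  exact Lp.eLpNorm_ne_top X

/-- Moving mass from a set where `f` is large to one where `f` is small, in proportion such that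
the mean is preserved and in an amount small enough not to cross the level `(a + b) / 2`, decreases
`f` in second-order stochastic dominance. -/
theorem add_mem_dominatedSet {P Q : Measure Ω} [IsFiniteMeasure Q] (hQ : Q ≪ P)
    {R : ℝ} {g : Ω → ℝ} {f E : Lp ℝ 2 P} (hf : f ∈ dominatedSet P Q R g) {A A' : Set Ω}
    (hA : MeasurableSet A) (hA' : MeasurableSet A') {a b s s' : ℝ} (hab : a < b)
    (hfA : ∀ ω ∈ A, b ≤ f ω) (hfA' : ∀ ω ∈ A', f ω ≤ a) (hPA : P A ≠ 0) (hPA' : P A' ≠ 0)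
    (hs : 0 ≤ s) (hs' : 0 ≤ s') (hsb : s ≤ (b - a) / 2) (hsb' : s' ≤ (b - a) / 2)
    (hE : E =ᵐ[P] fun ω => A'.indicator (fun _ => s') ω - A.indicator (fun _ => s) ω)
    (hbal : Q.real A' * s' = Q.real A * s) : f + E ∈ dominatedSet P Q R g := by
  set e : Ω → ℝ := fun ω => A'.indicator (fun _ => s') ω - A.indicator (fun _ => s) ω with he
  have hadd : ∀ᵐ ω ∂P, (f + E) ω = f ω + e ω := by
    filter_upwards [Lp.coeFn_add f E, hE] with ω h1 h2
    rw [h1, Pi.add_apply, h2]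
  -- as `A` and `A'` are not null, the interval `[a, b]` lies within the bounds `±R` of `f`
  have hbA : b ≤ R := by
    obtain ⟨ω, hω, h⟩ := (Frequently.and_eventually (frequently_ae_mem_iff.2 hPA) hf.1).exists
    exact (hfA ω hω).trans (le_of_abs_le h)
  have haA : -R ≤ a := by
    obtain ⟨ω, hω, h⟩ := (Frequently.and_eventually (frequently_ae_mem_iff.2 hPA') hf.1).exists
    exact (neg_le_of_abs_le h).trans (hfA' ω hω)
  have hm : ∀ ω, e ω = 0 ∨ ((a + b) / 2 ≤ f ω + e ω ∧ e ω ≤ 0) ∨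
      (0 ≤ e ω ∧ f ω + e ω ≤ (a + b) / 2) := by
    intro ω
    by_cases h : ω ∈ A
    · have h' : ω ∉ A' := fun h' => by linarith [hfA ω h, hfA' ω h']
      right; left
      have : e ω = -s := by simp [he, h, h']
      rw [this]
      constructor <;> linarith [hfA ω h]
    · by_cases h' : ω ∈ A'
      · right; right
        have : e ω = s' := by simp [he, h, h']
        rw [this]
        constructor <;> linarith [hfA' ω h']
      · left; simp [he, h, h']
  have hbd : ∀ᵐ ω ∂P, |f ω + e ω| ≤ R := by
    filter_upwards [hf.1] with ω h
    rw [abs_le] at *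
    rcases hm ω with h1 | ⟨h1, h2⟩ | ⟨h1, h2⟩
    · rw [h1, add_zero]; exact h
    · constructor <;> linarith
    · constructor <;> linarith
  refine ⟨?_, fun v hv hmono => ?_⟩
  · filter_upwards [hadd, hbd] with ω h1 h2
    rwa [h1]
  have i1 : Integrable (A'.indicator fun _ => s') Q := (integrable_const s').indicator hA'
  have i2 : Integrable (A.indicator fun _ => s) Q := (integrable_const s).indicator hA
  refine le_trans ?_ (hf.2 v hv hmono)
  calc ∫ ω, v ((f + E) ω) ∂Q = ∫ ω, v (f ω + e ω) ∂Q :=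
        integral_congr_ae (hQ.ae_le (hadd.mono fun ω h => by simp only [h]))
    _ ≤ ∫ ω, v (f ω) ∂Q := by
        refine integral_comp_add_le hv ((Lp.aestronglyMeasurable f).mono_ac hQ) (i1.sub i2)
          (hQ.ae_le hf.1) (hQ.ae_le hbd) (ae_of_all _ hm) ?_
        rw [he, integral_sub i1 i2, integral_indicator_const _ hA', integral_indicator_const _ hA,
          smul_eq_mul, smul_eq_mul, hbal, sub_self]

section Improvement

variable {P : Measure Ω} {ι : Type*} [Fintype ι]

/-- Among the allocations of `X` whose `i`-th component is dominated by `g i` under `Q i`, there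
is one of minimal norm in `L²`, characterised by a variational inequality. -/
theorem exists_minimal_allocation {Q : ι → Measure Ω} [∀ i, IsFiniteMeasure (Q i)]
    (hQ : ∀ i, Q i ≪ P) (R : ℝ) (g : ι → Ω → ℝ) (X : Lp ℝ 2 P)
    (hne : ∃ y : ι → Lp ℝ 2 P, ∑ i, y i = X ∧ ∀ i, y i ∈ dominatedSet P (Q i) R (g i)) :
    ∃ y : ι → Lp ℝ 2 P, (∑ i, y i = X ∧ ∀ i, y i ∈ dominatedSet P (Q i) R (g i)) ∧
      ∀ z : ι → Lp ℝ 2 P, ∑ i, z i = X → (∀ i, z i ∈ dominatedSet P (Q i) R (g i)) →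
        0 ≤ ∑ i, inner ℝ (y i) (z i - y i) := by
  let C : Set (PiLp 2 fun _ : ι => Lp ℝ 2 P) :=
    {y | ∑ i, y i = X ∧ ∀ i, y i ∈ dominatedSet P (Q i) R (g i)}
  have hC : Convex ℝ C := by
    rintro y ⟨h1, h1'⟩ z ⟨h2, h2'⟩ a b ha hb hab
    refine ⟨?_, fun i => convex_dominatedSet (hQ i) R (g i) (h1' i) (h2' i) ha hb hab⟩
    simp only [PiLp.add_apply, PiLp.smul_apply, Finset.sum_add_distrib, ← Finset.smul_sum, h1, h2]
    rw [← add_smul, hab, one_smul]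
  have hcl : IsClosed C := by
    have hcont : ∀ i, Continuous fun y : PiLp 2 fun _ : ι => Lp ℝ 2 P => y i := fun i => by
      fun_prop
    have hC' : C = {y | ∑ i, y i = X} ∩ ⋂ i, {y | y i ∈ dominatedSet P (Q i) R (g i)} := by
      ext y
      simp [C]
    rw [hC']
    exact (isClosed_eq (continuous_finsetSum _ fun i _ => hcont i) continuous_const).inter
      (isClosed_iInter fun i => (isClosed_dominatedSet (hQ i) R (g i)).preimage (hcont i))
  obtain ⟨y₀, hy₀⟩ := hne
  obtain ⟨y, hy, hmin⟩ := exists_norm_eq_iInf_of_complete_convex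
    (K := C) ⟨WithLp.toLp 2 y₀, hy₀⟩ hcl.isComplete hC 0
  refine ⟨fun i => y i, hy, fun z hz hz' => ?_⟩
  have := (norm_eq_iInf_iff_real_inner_le_zero hC hy).1 hmin (WithLp.toLp 2 z) ⟨hz, hz'⟩
  rw [zero_sub, inner_neg_left, neg_nonpos, PiLp.inner_apply] at this
  exact this

/-- An allocation of minimal norm is comonotone on every cell on which the measures `Q i` are
multiples of `P`: otherwise a small exchange between two agents would improve it. -/
theorem measure_eq_zero_of_minimal [IsProbabilityMeasure P] {Q : ι → Measure Ω}
    [∀ i, IsFiniteMeasure (Q i)] (hQ : ∀ i, Q i ≪ P) {R : ℝ} {g : ι → Ω → ℝ} {X : Lp ℝ 2 P}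
    {y : ι → Lp ℝ 2 P}
    (hy : ∑ i, y i = X) (hy' : ∀ i, y i ∈ dominatedSet P (Q i) R (g i))
    (hmin : ∀ z : ι → Lp ℝ 2 P, ∑ i, z i = X → (∀ i, z i ∈ dominatedSet P (Q i) R (g i)) →
        0 ≤ ∑ i, inner ℝ (y i) (z i - y i))
    {B : Set Ω} (hB : MeasurableSet B)
    (hw : ∀ i, ∃ w : ℝ, ∀ A ⊆ B, MeasurableSet A → (Q i).real A = w * P.real A)
    {i j : ι} (hij : i ≠ j) {a b c d : ℝ} (hab : a < b) (hcd : c < d) :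
    P {ω | ω ∈ B ∧ b < y i ω ∧ y j ω < c} = 0 ∨ P {ω | ω ∈ B ∧ y i ω < a ∧ d < y j ω} = 0 := by
  classical
  by_contra! hcon
  have hmeas : ∀ k, Measurable (y k) := fun k => (Lp.stronglyMeasurable (y k)).measurable
  set A := {ω | ω ∈ B ∧ b < y i ω ∧ y j ω < c} with hAdef
  set A' := {ω | ω ∈ B ∧ y i ω < a ∧ d < y j ω} with hA'def
  obtain ⟨hPA, hPA'⟩ := hcon
  have hA : MeasurableSet A := hB.inter ((measurableSet_lt measurable_const (hmeas i)).inter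
    (measurableSet_lt (hmeas j) measurable_const))
  have hA' : MeasurableSet A' := hB.inter ((measurableSet_lt (hmeas i) measurable_const).inter
    (measurableSet_lt measurable_const (hmeas j)))
  have hα : 0 < P.real A := ENNReal.toReal_pos hPA (measure_ne_top _ _)
  have hα' : 0 < P.real A' := ENNReal.toReal_pos hPA' (measure_ne_top _ _)
  obtain ⟨t, ht, hti, htj⟩ : ∃ t : ℝ, 0 < t ∧ t ≤ (b - a) / 2 ∧ t ≤ (d - c) / 2 :=
    ⟨min ((b - a) / 2) ((d - c) / 2), lt_min (by linarith) (by linarith), min_le_left _ _,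
      min_le_right _ _⟩
  -- the exchanged amount is chosen so that it has mean zero
  set s := t * P.real A' with hs
  set s' := t * P.real A with hs'
  have hs0 : 0 < s := mul_pos ht hα'
  have hs0' : 0 < s' := mul_pos ht hα
  have hst : s ≤ t := mul_le_of_le_one_right ht.le measureReal_le_one
  have hst' : s' ≤ t := mul_le_of_le_one_right ht.le measureReal_le_one
  let e : Ω → ℝ := fun ω => A'.indicator (fun _ => s') ω - A.indicator (fun _ => s) ω
  have he : MemLp e 2 P :=
    (memLp_indicator_const 2 hA' s' (Or.inr (measure_ne_top _ _))).sub
      (memLp_indicator_const 2 hA s (Or.inr (measure_ne_top _ _)))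
  set E : Lp ℝ 2 P := he.toLp e with hE
  have hEe : E =ᵐ[P] e := he.coeFn_toLp
  have hbal : ∀ k, (Q k).real A' * s' = (Q k).real A * s := fun k => by
    obtain ⟨w, hw⟩ := hw k
    rw [hw A (fun ω h => h.1) hA, hw A' (fun ω h => h.1) hA']
    ring
  let z : ι → Lp ℝ 2 P := fun k => y k + ((if k = i then E else 0) - if k = j then E else 0)
  have hzsum : ∑ k, z k = X := by
    simp only [z, Finset.sum_add_distrib, Finset.sum_sub_distrib, Finset.sum_ite_eq',
      Finset.mem_univ, if_true, sub_self, add_zero, hy]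
  have hzmem : ∀ k, z k ∈ dominatedSet P (Q k) R (g k) := by
    intro k
    by_cases hki : k = i
    · subst hki
      simp only [z, if_true, if_neg hij, sub_zero]
      exact add_mem_dominatedSet (hQ k) (hy' k) hA hA' hab (fun ω h => h.2.1.le)
        (fun ω h => h.2.1.le) hPA hPA' hs0.le hs0'.le (hst.trans hti) (hst'.trans hti) hEe (hbal k)
    · by_cases hkj : k = j
      · subst hkj
        simp only [z, if_true, if_neg hki, zero_sub]
        -- agent `j` makes the opposite exchange, so that `A` and `A'` swap their roles
        refine add_mem_dominatedSet (hQ k) (hy' k) hA' hA hcd (fun ω h => h.2.2.le)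
          (fun ω h => h.2.2.le) hPA' hPA hs0'.le hs0.le (hst'.trans htj) (hst.trans htj) ?_
          (hbal k).symm
        filter_upwards [Lp.coeFn_neg E, hEe] with ω h1 h2
        rw [h1, Pi.neg_apply, h2, neg_sub]
      · simp only [z, if_neg hki, if_neg hkj, sub_zero, add_zero]
        exact hy' k
  have h1 := hmin z hzsum hzmem
  have h2 : ∑ k, inner ℝ (y k) (z k - y k) = inner ℝ (y i - y j) E := by
    simp only [z, add_sub_cancel_left, inner_sub_right, Finset.sum_sub_distrib]
    rw [Finset.sum_eq_single i (fun k _ hk => by simp [hk]) (by simp),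
      Finset.sum_eq_single j (fun k _ hk => by simp [hk]) (by simp)]
    simp [inner_sub_left]
  rw [h2, L2.inner_def] at h1
  let K : Ω → ℝ := fun ω => A'.indicator (fun _ => s' * (a - d)) ω -
    A.indicator (fun _ => s * (b - c)) ω
  have i1 : Integrable (A'.indicator fun _ => s' * (a - d)) P := (integrable_const _).indicator hA'
  have i2 : Integrable (A.indicator fun _ => s * (b - c)) P := (integrable_const _).indicator hA
  -- `y i - y j` exceeds `b - c` on `A` and is below `a - d` on `A'`
  have h3 : ∫ ω, inner ℝ ((y i - y j : Lp ℝ 2 P) ω) (E ω) ∂P ≤ ∫ ω, K ω ∂P := by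
    refine integral_mono_ae (L2.integrable_inner _ _) (i1.sub i2) ?_
    filter_upwards [hEe, Lp.coeFn_sub (y i) (y j)] with ω h1 h2
    rw [h1, h2]
    simp only [Pi.sub_apply, RCLike.inner_apply, conj_trivial, K, e]
    by_cases h : ω ∈ A
    · have h' : ω ∉ A' := fun h' => by linarith [h.2.1, h'.2.1]
      simp only [h, h', Set.indicator_of_mem, Set.indicator_of_notMem, not_false_eq_true]
      nlinarith [h.2.1, h.2.2]
    · by_cases h' : ω ∈ A'
      · simp only [h, h', Set.indicator_of_mem, Set.indicator_of_notMem, not_false_eq_true]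
        nlinarith [h'.2.1, h'.2.2]
      · simp [h, h']
  have h4 : ∫ ω, K ω ∂P = P.real A' * (s' * (a - d)) - P.real A * (s * (b - c)) := by
    rw [integral_sub i1 i2, integral_indicator_const _ hA', integral_indicator_const _ hA]
    rfl
  have h5 : P.real A' * (s' * (a - d)) - P.real A * (s * (b - c))
      = -(t * P.real A * P.real A' * ((b - a) + (d - c))) := by
    rw [hs, hs']; ring
  have h6 : 0 < t * P.real A * P.real A' * ((b - a) + (d - c)) := by
    have : 0 < (b - a) + (d - c) := by linarith
    positivity
  linarith

/-- Comonotone increments are dominated by the increment of the aggregate. -/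
theorem abs_sub_le_abs_sum_sub {u u' : ι → ℝ}
    (h : ∀ i j, i ≠ j → ¬ (u' i < u i ∧ u j < u' j)) (i : ι) :
    |u i - u' i| ≤ |∑ k, u k - ∑ k, u' k| := by
  rw [← Finset.sum_sub_distrib]
  rcases lt_trichotomy (u i) (u' i) with hi | hi | hi
  · have hk : ∀ k, 0 ≤ u' k - u k := fun k => by
      by_contra! hk
      exact h k i (by rintro rfl; linarith) ⟨by linarith, hi⟩
    rw [abs_sub_comm, abs_of_pos (by linarith), ← abs_neg, ← Finset.sum_neg_distrib]
    simp only [neg_sub]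
    exact (Finset.single_le_sum (f := fun k => u' k - u k) (fun k _ => hk k)
      (Finset.mem_univ i)).trans (le_abs_self _)
  · simp [hi]
  · have hk : ∀ k, 0 ≤ u k - u' k := fun k => by
      by_contra! hk
      exact h i k (by rintro rfl; linarith) ⟨hi, by linarith⟩
    rw [abs_of_pos (by linarith)]
    exact (Finset.single_le_sum (f := fun k => u k - u' k) (fun k _ => hk k)
      (Finset.mem_univ i)).trans (le_abs_self _)

/-- A function whose increments are dominated by those of `X` on each cell of a set of full
measure is a `1`-Lipschitz function of `X` on each cell. -/
theorem exists_lipschitz_factor {Ω J : Type*} {κ : Ω → J} {X Y : Ω → ℝ} {S : Set Ω}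
    (h : ∀ ω ∈ S, ∀ ω' ∈ S, κ ω = κ ω' → |Y ω - Y ω'| ≤ |X ω - X ω'|) :
    ∃ f : J → ℝ → ℝ, (∀ c, LipschitzWith 1 (f c)) ∧ ∀ ω ∈ S, Y ω = f (κ ω) (X ω) := by
  have key : ∀ c, ∃ f : ℝ → ℝ, LipschitzWith 1 f ∧ ∀ ω ∈ S, κ ω = c → Y ω = f (X ω) := by
    intro c
    rcases isEmpty_or_nonempty Ω with hΩ | hΩ
    · exact ⟨fun _ => 0, LipschitzWith.const' _, fun ω => isEmptyElim ω⟩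
    -- `r` picks a point of the cell with a given value of `X`; `Y` does not depend on the choice
    let T := S ∩ κ ⁻¹' {c}
    let r := Function.invFunOn X T
    have hr : ∀ x ∈ X '' T, r x ∈ T ∧ X (r x) = x := fun x hx =>
      ⟨Function.invFunOn_mem hx, Function.invFunOn_eq hx⟩
    have hlip : LipschitzOnWith 1 (fun x => Y (r x)) (X '' T) := by
      refine LipschitzOnWith.of_dist_le_mul fun x hx x' hx' => ?_
      obtain ⟨h1, h2⟩ := hr x hx
      obtain ⟨h1', h2'⟩ := hr x' hx'
      have := h _ h1.1 _ h1'.1 (h1.2.trans h1'.2.symm)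
      rw [h2, h2'] at this
      simpa [Real.dist_eq] using this
    obtain ⟨f, hf, hfe⟩ := hlip.extend_real
    refine ⟨f, hf, fun ω hω hc => ?_⟩
    have hx : X ω ∈ X '' T := ⟨ω, ⟨hω, hc⟩, rfl⟩
    rw [← hfe hx]
    obtain ⟨h1, h2⟩ := hr _ hx
    have := h _ hω _ h1.1 (hc.trans h1.2.symm)
    rw [h2, sub_self, abs_zero] at this
    exact sub_eq_zero.1 (abs_nonpos_iff.1 this)
  choose f hf hfe using key
  exact ⟨f, hf, fun ω hω => hfe _ ω hω rfl⟩

/-- Every allocation is improved, in the stochastic dominance of each agent, by one which is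
comonotone on the cells of a partition on which the reference measures are multiples of `P`. -/
theorem exists_locallyLipschitz_improvement [IsProbabilityMeasure P] {Q : ι → Measure Ω}
    [∀ i, IsFiniteMeasure (Q i)] (hQ : ∀ i, Q i ≪ P) {J : Type*} [Countable J] {κ : Ω → J}
    (hκ : ∀ c, MeasurableSet (κ ⁻¹' {c}))
    (hw : ∀ i c, ∃ w : ℝ, ∀ A ⊆ κ ⁻¹' {c}, MeasurableSet A → (Q i).real A = w * P.real A)
    (W : ι → LInf P) :
    ∃ Y : ι → LInf P, ∑ i, Y i = ∑ i, W i ∧ (∀ i, SSDominates (Q i) (W i) (Y i)) ∧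
      ∀ i, Y i ∈ locallyLipschitzSet κ (∑ i, W i) := by
  classical
  set X := ∑ i, W i with hX
  set R := ∑ i, ‖W i‖ with hR
  have hWR : ∀ i, ‖W i‖ ≤ R := fun i =>
    Finset.single_le_sum (f := fun i => ‖W i‖) (fun _ _ => norm_nonneg _) (Finset.mem_univ i)
  have hm : ∀ U : LInf P, MemLp U 2 P := fun U => (Lp.memLp U).mono_exponent le_top
  have hsum : ∀ (p : ℝ≥0∞) (y : ι → Lp ℝ p P), (∑ i, y i : Lp ℝ p P) =ᵐ[P] fun ω => ∑ i, y i ω :=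
    fun p y => Lp.coeFn_fun_finsetSum _ y
  -- `W` itself, viewed in `L²`, shows that there are competitors
  obtain ⟨y, ⟨hy, hy'⟩, hmin⟩ := exists_minimal_allocation hQ R (fun i => W i) ((hm X).toLp X)
    ⟨fun i => (hm (W i)).toLp (W i), by
      refine Lp.ext ?_
      filter_upwards [hsum 2 fun i => (hm (W i)).toLp (W i), (hm X).coeFn_toLp, hsum ∞ W,
        ae_all_iff.2 fun i => (hm (W i)).coeFn_toLp] with ω h1 h2 h3 h4
      rw [h1, h2, h3]
      exact Finset.sum_congr rfl fun i _ => h4 i, fun i => by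
      refine ⟨?_, fun v _ _ => le_of_eq ?_⟩
      · filter_upwards [(hm (W i)).coeFn_toLp, ae_abs_le_norm (W i)] with ω h1 h2
        rw [h1]
        exact h2.trans (hWR i)
      · exact integral_congr_ae ((hQ i).ae_le ((hm (W i)).coeFn_toLp.mono fun ω h => by
          simp only [h]))⟩
  have hYm : ∀ i, MemLp (y i) ∞ P := fun i =>
    memLp_top_of_bound (Lp.aestronglyMeasurable _) R (hy' i).1
  have hyX : ∀ᵐ ω ∂P, ∑ i, y i ω = X ω := by
    filter_upwards [hsum 2 y, (hm X).coeFn_toLp] with ω h1 h2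
    rw [← h1, hy, h2]
  refine ⟨fun i => (hYm i).toLp (y i), ?_, fun i v hv hmono => ?_, fun i => ?_⟩
  · refine Lp.ext ?_
    filter_upwards [hsum ∞ fun i => (hYm i).toLp (y i), hyX,
      ae_all_iff.2 fun i => (hYm i).coeFn_toLp] with ω h1 h2 h3
    rw [h1, ← h2]
    exact Finset.sum_congr rfl fun i _ => h3 i
  · refine le_trans (le_of_eq ?_) ((hy' i).2 v hv hmono)
    exact integral_congr_ae ((hQ i).ae_le ((hYm i).coeFn_toLp.mono fun ω h => by simp only [h]))
  · -- outside of a null set, no pair of points of a cell witnesses a failure of comonotonicity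
    let A : ι → ι → J → ℚ → ℚ → Set Ω := fun i j c q r =>
      {ω | ω ∈ κ ⁻¹' {c} ∧ q < y i ω ∧ y j ω < r}
    have hnull : ∀ᵐ ω ∂P, ∀ i j c q r, P (A i j c q r) = 0 → ω ∉ A i j c q r := by
      simp only [ae_all_iff]
      exact fun i j c q r h => measure_eq_zero_iff_ae_notMem.1 h
    obtain ⟨f, hf, hfe⟩ := exists_lipschitz_factor (κ := κ) (X := X) (Y := y i)
      (S := {ω | (∀ i j c q r, P (A i j c q r) = 0 → ω ∉ A i j c q r) ∧ ∑ i, y i ω = X ω}) (by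
        rintro ω ⟨h1, h2⟩ ω' ⟨h1', h2'⟩ hc
        rw [← h2, ← h2']
        refine abs_sub_le_abs_sum_sub (u := fun k => y k ω) (u' := fun k => y k ω') ?_ i
        rintro k l hkl ⟨hk, hl⟩
        obtain ⟨a, ha, hak⟩ := exists_rat_btwn hk
        obtain ⟨b, hab, hb⟩ := exists_rat_btwn hak
        obtain ⟨c, hc1, hcl⟩ := exists_rat_btwn hl
        obtain ⟨d, hcd, hd⟩ := exists_rat_btwn hcl
        rcases measure_eq_zero_of_minimal hQ hy hy' hmin (hκ (κ ω)) (fun i => hw i _) hkl hab hcd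
          with h | h
        · exact h1 k l (κ ω) b c h ⟨rfl, hb, hc1⟩
        · refine h1' l k (κ ω) d a ?_ ⟨hc.symm, hd, ha⟩
          convert h using 3
          ext ω
          simp [and_comm])
    refine ⟨f, hf, ?_⟩
    filter_upwards [(hYm i).coeFn_toLp, hnull, hyX] with ω h1 h2 h3
    rw [h1]
    exact hfe ω ⟨h2, h3⟩

end Improvement

/-! ### Compactness of locally Lipschitz functions of the aggregate -/

theorem norm_le_of_ae_abs_le {P : Measure Ω} [IsFiniteMeasure P] {X : LInf P} {C : ℝ} (hC : 0 ≤ C)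
    (h : ∀ᵐ ω ∂P, |X ω| ≤ C) : ‖X‖ ≤ C := by
  simpa using Lp.norm_le_of_ae_bound (p := ∞) hC h

/-- Bounded families of locally Lipschitz functions of `X` are relatively compact in `L^∞`, by the
theorem of Arzelà and Ascoli. -/
theorem exists_isCompact_locallyLipschitzSet {P : Measure Ω} [IsProbabilityMeasure P] {J : Type*}
    [Finite J] {κ : Ω → J} (hκ : ∀ c, MeasurableSet (κ ⁻¹' {c})) (X : LInf P) (R : ℝ) :
    ∃ K : Set (LInf P), IsCompact K ∧ ∀ Y ∈ locallyLipschitzSet κ X, ‖Y‖ ≤ R → Y ∈ K := by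
  rcases lt_or_ge R 0 with hR | hR
  · exact ⟨∅, isCompact_empty, fun Y _ h => absurd ((norm_nonneg Y).trans h) (not_le.2 hR)⟩
  have := Fintype.ofFinite J
  let _ : MeasurableSpace J := ⊤
  have hκm : Measurable κ := measurable_to_countable' hκ
  have hI : -‖X‖ ≤ ‖X‖ := by linarith [norm_nonneg X]
  let I := Set.Icc (-‖X‖) ‖X‖
  let π : ℝ → I := Set.projIcc _ _ hI
  let F : (J → BoundedContinuousFunction I ℝ) → Ω → ℝ := fun f ω => f (κ ω) (π (X ω))
  have hF : ∀ f, MemLp (F f) ∞ P := fun f => by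
    have h1 : Measurable fun p : J × I => f p.1 p.2 :=
      measurable_from_prod_countable_right fun c => (f c).continuous.measurable
    have h2 : Measurable (F f) := h1.comp (hκm.prodMk
      ((continuous_projIcc (h := hI)).measurable.comp (Lp.stronglyMeasurable X).measurable))
    exact memLp_top_of_bound h2.aestronglyMeasurable ‖f‖ (ae_of_all _ fun ω =>
      ((f (κ ω)).norm_coe_le_norm _).trans (norm_le_pi_norm f _))
  let T : (J → BoundedContinuousFunction I ℝ) → LInf P := fun f => (hF f).toLp (F f)
  have hT : Continuous T := by
    refine (LipschitzWith.of_dist_le_mul (K := 1) fun f g => ?_).continuous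
    rw [NNReal.coe_one, one_mul, dist_eq_norm, ← MemLp.toLp_sub]
    refine norm_le_of_ae_abs_le dist_nonneg ?_
    filter_upwards [((hF f).sub (hF g)).coeFn_toLp] with ω h
    rw [h, Pi.sub_apply, ← Real.dist_eq]
    exact (BoundedContinuousFunction.dist_coe_le_dist _).trans (dist_le_pi_dist f g (κ ω))
  let A : Set (BoundedContinuousFunction I ℝ) :=
    {f | LipschitzWith 1 f ∧ ∀ x, f x ∈ Set.Icc (-R) R}
  have hA : IsCompact (closure A) := by
    refine BoundedContinuousFunction.arzela_ascoli (Set.Icc (-R) R) isCompact_Icc A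
      (fun f x hf => hf.2 x) ?_
    refine Metric.equicontinuous_of_continuity_modulus id tendsto_id _ fun x y f => ?_
    simpa using f.2.1.dist_le_mul x y
  refine ⟨T '' Set.univ.pi fun _ => closure A, (isCompact_univ_pi fun _ => hA).image hT, ?_⟩
  rintro Y ⟨h, hh, hY⟩ hYR
  -- truncating at the level `R` makes the representing functions bounded on null cells as well
  have hclip : ∀ c, LipschitzWith 1 fun x : I => max (-R) (min R (h c x)) := fun c =>
    (((hh c).comp (LipschitzWith.subtype_val I)).const_min R).const_max (-R) |>.weaken (by simp)
  have hmem : ∀ c (x : I), max (-R) (min R (h c x)) ∈ Set.Icc (-R) R := fun c x =>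
    ⟨le_max_left _ _, max_le (by linarith) (min_le_left _ _)⟩
  let f : J → BoundedContinuousFunction I ℝ := fun c =>
    BoundedContinuousFunction.mkOfCompact ⟨_, (hclip c).continuous⟩
  have hTf : T f =ᵐ[P] F f := (hF f).coeFn_toLp
  refine ⟨f, fun c _ => subset_closure ⟨hclip c, hmem c⟩, Lp.ext (hTf.trans ?_)⟩
  filter_upwards [hY, ae_abs_le_norm X, ae_abs_le_norm Y] with ω h1 h2 h3
  have hπ : (π (X ω) : ℝ) = X ω :=
    congrArg Subtype.val (Set.projIcc_of_mem hI (abs_le.1 h2))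
  have h4 := abs_le.1 (h3.trans hYR)
  rw [h1] at h4
  simp only [F, f, BoundedContinuousFunction.mkOfCompact_apply, ContinuousMap.coe_mk, hπ]
  rw [min_eq_right h4.2, max_eq_right h4.1, h1]

theorem smul_mem_locallyLipschitzSet {P : Measure Ω} {J : Type*} {κ : Ω → J} {X Y : LInf P}
    (hY : Y ∈ locallyLipschitzSet κ X) {r : ℝ} (hr : |r| ≤ 1) :
    r • Y ∈ locallyLipschitzSet κ X := by
  obtain ⟨h, hh, hY⟩ := hY
  refine ⟨fun c x => r * h c x, fun c => LipschitzWith.of_dist_le_mul fun x y => ?_, ?_⟩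
  · have := (hh c).dist_le_mul x y
    rw [Real.dist_eq] at *
    rw [← mul_sub, abs_mul]
    exact (mul_le_of_le_one_left (abs_nonneg _) hr).trans this
  · filter_upwards [Lp.coeFn_smul r Y, hY] with ω h1 h2
    rw [h1, Pi.smul_apply, h2, smul_eq_mul]

theorem add_const_mem_locallyLipschitzSet {P : Measure Ω} [IsFiniteMeasure P] {J : Type*}
    {κ : Ω → J} {X Y : LInf P} (hY : Y ∈ locallyLipschitzSet κ X) (m : ℝ) :
    Y + Lp.const ∞ P m ∈ locallyLipschitzSet κ X := by
  obtain ⟨h, hh, hY⟩ := hY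
  refine ⟨fun c x => h c x + m, fun c => LipschitzWith.of_dist_le_mul fun x y => ?_, ?_⟩
  · simpa using (hh c).dist_le_mul x y
  · filter_upwards [Lp.coeFn_add Y (Lp.const ∞ P m), Lp.coeFn_const ∞ P m, hY] with ω h1 h2 h3
    rw [h1, Pi.add_apply, h2, h3, Function.const_apply]

/-! ### Partitions carried by simple densities -/

/-- Finitely many simple densities are constant on the cells of a common finite partition, encoded
by the map `κ` to the index set of the cells. -/
theorem exists_partition_of_hasSimpleDensity {P : Measure Ω} [IsProbabilityMeasure P] {ι : Type}
    [Finite ι] {Q : ι → Measure Ω} [∀ i, IsFiniteMeasure (Q i)] (hQ : ∀ i, Q i ≪ P)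
    (hs : ∀ i, HasSimpleDensity P (Q i)) :
    ∃ (J : Type) (_ : Finite J) (κ : Ω → J), (∀ c, MeasurableSet (κ ⁻¹' {c})) ∧
      ∀ i c, ∃ w : ℝ, ∀ A ⊆ κ ⁻¹' {c}, MeasurableSet A → (Q i).real A = w * P.real A := by
  choose f hf using hs
  refine ⟨(i : ι) → (f i).range, inferInstance, fun ω i => ⟨f i ω, SimpleFunc.mem_range_self _ _⟩,
    fun c => ?_, fun i c => ⟨c i, fun A hA hAm => ?_⟩⟩
  · have : (fun ω i => (⟨f i ω, SimpleFunc.mem_range_self _ _⟩ : (f i).range)) ⁻¹' {c}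
        = ⋂ i, f i ⁻¹' {(c i : ℝ)} := by
      ext ω
      simp [funext_iff, Subtype.ext_iff]
    rw [this]
    exact MeasurableSet.iInter fun i => (f i).measurableSet_fiber _
  · rw [← Measure.setIntegral_toReal_rnDeriv (hQ i) A,
      setIntegral_congr_ae hAm (g := fun _ => (c i : ℝ)), setIntegral_const, smul_eq_mul, mul_comm]
    filter_upwards [hf i] with ω h1 h2
    rw [h1]
    have := congrFun (hA h2) i
    exact congrArg Subtype.val this

/-! ### Monetary risk measures and asymptotic cones -/

theorem norm_const_le {P : Measure Ω} [IsFiniteMeasure P] (m : ℝ) :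
    ‖(Lp.const ∞ P m : LInf P)‖ ≤ |m| :=
  norm_le_of_ae_abs_le (abs_nonneg m) ((Lp.coeFn_const ∞ P m).mono fun ω h => by
    rw [h, Function.const_apply])

theorem IsMonetary.le_add_norm_sub {P : Measure Ω} [IsProbabilityMeasure P] {ρ : LInf P → ℝ}
    (hρ : IsMonetary ρ) (X Y : LInf P) : ρ X ≤ ρ Y + ‖X - Y‖ := by
  rw [← hρ.cash_additive]
  refine hρ.monotone _ _ ?_
  rw [← Lp.coeFn_le]
  filter_upwards [Lp.coeFn_add Y (Lp.const ∞ P ‖X - Y‖), Lp.coeFn_const ∞ P ‖X - Y‖,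
    Lp.coeFn_sub X Y, ae_abs_le_norm (X - Y)] with ω h1 h2 h3 h4
  rw [h1, Pi.add_apply, h2, Function.const_apply]
  rw [h3, Pi.sub_apply] at h4
  linarith [le_of_abs_le h4]

theorem IsMonetary.continuous {P : Measure Ω} [IsProbabilityMeasure P] {ρ : LInf P → ℝ}
    (hρ : IsMonetary ρ) : Continuous ρ :=
  (LipschitzWith.of_le_add fun X Y => by
    rw [dist_eq_norm]; exact hρ.le_add_norm_sub X Y).continuous

theorem exists_le_add_of_iSup_conjugate_lt_top {P : Measure Ω} {ι : Type*} {ρ : ι → LInf P → ℝ}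
    {φ : StrongDual ℝ (LInf P)} (h : (⨆ k, conjugate (ρ k) φ) < ⊤) :
    ∃ C : ℝ, ∀ k X, φ X ≤ ρ k X + C := by
  obtain ⟨C, hC, -⟩ := EReal.lt_iff_exists_real_btwn.1 h
  refine ⟨C, fun k X => ?_⟩
  have h1 : ((φ X - ρ k X : ℝ) : EReal) ≤ C :=
    ((le_iSup (fun X => ((φ X - ρ k X : ℝ) : EReal)) X).trans
      (le_iSup (fun k => conjugate (ρ k) φ) k)).trans hC.le
  have := EReal.coe_le_coe_iff.1 h1
  linarith

/-- A functional with finite conjugate value is nonpositive on the asymptotic cone. -/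
theorem apply_nonpos_of_mem_asymptoticCone {P : Measure Ω} {ρ : LInf P → ℝ}
    {φ : StrongDual ℝ (LInf P)} {C : ℝ} (h : ∀ X, φ X ≤ ρ X + C) {U : LInf P}
    (hU : U ∈ asymptoticCone ρ) : φ U ≤ 0 := by
  obtain ⟨s, Y, hs, hY, hs0, hU⟩ := hU
  have h1 : Tendsto (fun k => s k * C) atTop (𝓝 0) := by simpa using hs0.mul_const C
  refine le_of_tendsto_of_tendsto' ((φ.continuous.tendsto U).comp hU) h1 fun k => ?_
  simp only [Function.comp_apply, map_smul, smul_eq_mul]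
  have h2 : ρ (Y k) ≤ 0 := hY k
  exact mul_le_mul_of_nonneg_left (by linarith [h (Y k)]) (hs k).le

/-- Under the compatibility hypothesis, asymptotic directions summing up to zero vanish: no
agent but possibly the last has a nonzero one by compatibility, hence neither has the last. -/
theorem eq_zero_of_sum_eq_zero {P : Measure Ω} {n : ℕ} {ρ : Fin n → LInf P → ℝ}
    (hcompat : ∀ i : Fin n, (i : ℕ) + 1 < n → ∃ Z ∈ compatibleSet (ρ i),
      (⨆ k, conjugate (ρ k) (toDual Z)) < ⊤)
    {U : Fin n → LInf P} (hU : ∀ i, U i ∈ asymptoticCone (ρ i)) (hsum : ∑ i, U i = 0) : U = 0 := by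
  have h1 : ∀ i : Fin n, (i : ℕ) + 1 < n → U i = 0 := by
    intro i hi
    obtain ⟨Z, hZ, hfin⟩ := hcompat i hi
    obtain ⟨C, hC⟩ := exists_le_add_of_iSup_conjugate_lt_top hfin
    have h2 : ∀ k ∈ Finset.univ, toDual Z (U k) ≤ 0 := fun k _ =>
      apply_nonpos_of_mem_asymptoticCone (hC k) (hU k)
    have h3 : ∑ k, toDual Z (U k) = 0 := by rw [← map_sum, hsum, map_zero]
    have h4 := (Finset.sum_eq_zero_iff_of_nonpos h2).1 h3 i (Finset.mem_univ i)
    exact hZ.2 _ (hU i) (by rw [← toDual_apply]; exact h4)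
  funext i
  by_cases hi : (i : ℕ) + 1 < n
  · exact h1 i hi
  · rw [Finset.sum_eq_single i (fun k _ hk => h1 k ?_) (by simp)] at hsum
    · exact hsum
    · have := Fin.val_ne_of_ne hk
      omega

theorem bddBelow_aggregate_risk {P : Measure Ω} {n : ℕ} {ρ : Fin n → LInf P → ℝ}
    {φ : StrongDual ℝ (LInf P)}
    (h : (⨆ k, conjugate (ρ k) φ) < ⊤) (X : LInf P) :
    BddBelow ((fun W => ∑ i, ρ i (W i)) '' allocations n X) := by
  obtain ⟨C, hC⟩ := exists_le_add_of_iSup_conjugate_lt_top h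
  refine ⟨φ X - ∑ _i : Fin n, C, ?_⟩
  rintro _ ⟨W, rfl, rfl⟩
  rw [map_sum, ← Finset.sum_sub_distrib]
  exact Finset.sum_le_sum fun i _ => by linarith [hC i (W i)]

/-! ### Existence of optimal allocations -/

section Existence

variable {P : Measure Ω} [IsProbabilityMeasure P] {n : ℕ} {ρ : Fin n → LInf P → ℝ}

/-- Locally Lipschitz allocations whose components are acceptable and whose aggregates differ from
`X` by bounded constants are bounded. Otherwise, rescaling yields a nonzero family of asymptotic
directions with sum zero. -/
theorem exists_norm_le_of_acceptable
    (hcompat : ∀ i : Fin n, (i : ℕ) + 1 < n → ∃ Z ∈ compatibleSet (ρ i),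
      (⨆ k, conjugate (ρ k) (toDual Z)) < ⊤)
    {J : Type*} [Finite J] {κ : Ω → J} (hκ : ∀ c, MeasurableSet (κ ⁻¹' {c})) {X : LInf P}
    {V : ℕ → Fin n → LInf P} (hV : ∀ k i, V k i ∈ locallyLipschitzSet κ X)
    (hacc : ∀ k i, V k i ∈ acceptanceSet (ρ i)) {σ : ℕ → ℝ} {S : ℝ} (hσ : ∀ k, |σ k| ≤ S)
    (hsum : ∀ k, ∑ i, V k i = X + Lp.const ∞ P (σ k)) : ∃ R, ∀ k, ‖V k‖ ≤ R := by
  by_contra! hcon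
  choose k hk using fun m : ℕ => hcon (m + 1)
  have hpos : ∀ m, 0 < ‖V (k m)‖ := fun m => lt_trans (by positivity) (hk m)
  set s : ℕ → ℝ := fun m => ‖V (k m)‖⁻¹ with hs
  have hs_pos : ∀ m, 0 < s m := fun m => inv_pos.2 (hpos m)
  have hs_le : ∀ m : ℕ, s m ≤ 1 / ((m : ℝ) + 1) := fun m => by
    rw [hs, one_div]
    exact inv_anti₀ (by positivity) (hk m).le
  have hs0 : Tendsto s atTop (𝓝 0) :=
    squeeze_zero (fun m => (hs_pos m).le) hs_le tendsto_one_div_add_atTop_nhds_zero_nat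
  obtain ⟨K, hK, hKmem⟩ := exists_isCompact_locallyLipschitzSet hκ X 1
  have hnorm : ∀ m, ‖s m • V (k m)‖ = 1 := fun m => by
    rw [norm_smul, Real.norm_of_nonneg (hs_pos m).le]
    exact inv_mul_cancel₀ (hpos m).ne'
  have hmem : ∀ m, s m • V (k m) ∈ Set.univ.pi fun _ => K := fun m i _ => by
    refine hKmem _ (smul_mem_locallyLipschitzSet (hV _ i) ?_) ?_
    · rw [abs_of_pos (hs_pos m)]
      refine (hs_le m).trans ?_
      rw [div_le_one (by positivity)]
      linarith [Nat.cast_nonneg (α := ℝ) m]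
    · exact (norm_le_pi_norm (s m • V (k m)) i).trans (hnorm m).le
  obtain ⟨U, -, φ, hφ, hU⟩ := (isCompact_univ_pi fun _ => hK).tendsto_subseq hmem
  have hUnorm : ‖U‖ = 1 := tendsto_nhds_unique hU.norm (by simp [hnorm])
  have hUcone : ∀ i, U i ∈ asymptoticCone (ρ i) := fun i =>
    ⟨s ∘ φ, fun m => V (k (φ m)) i, fun m => hs_pos _, fun m => hacc _ i,
      hs0.comp hφ.tendsto_atTop, (tendsto_pi_nhds.1 hU) i⟩
  have hUsum : ∑ i, U i = 0 := by
    have h1 : Tendsto (fun m => ∑ i, (s (φ m) • V (k (φ m))) i) atTop (𝓝 (∑ i, U i)) :=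
      tendsto_finsetSum _ fun i _ => (tendsto_pi_nhds.1 hU) i
    refine tendsto_nhds_unique h1 ?_
    have h2 : Tendsto (fun m => s (φ m) * (‖X‖ + S)) atTop (𝓝 0) := by
      simpa using (hs0.comp hφ.tendsto_atTop).mul_const (‖X‖ + S)
    refine squeeze_zero_norm (fun m => ?_) h2
    simp only [Pi.smul_apply]
    rw [← Finset.smul_sum, hsum, norm_smul, Real.norm_of_nonneg (hs_pos _).le]
    exact mul_le_mul_of_nonneg_left ((norm_add_le _ _).trans
      (add_le_add le_rfl ((norm_const_le _).trans (hσ _)))) (hs_pos _).le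
  rw [eq_zero_of_sum_eq_zero hcompat hUcone hUsum, norm_zero] at hUnorm
  exact zero_ne_one hUnorm

/-- If every allocation can be improved to a locally Lipschitz one, then an optimal allocation
exists. -/
theorem exists_isOptimalAllocation (hn : 2 ≤ n) (hρ : ∀ i, IsMonetary (ρ i))
    (hcompat : ∀ i : Fin n, (i : ℕ) + 1 < n → ∃ Z ∈ compatibleSet (ρ i),
      (⨆ k, conjugate (ρ k) (toDual Z)) < ⊤)
    {J : Type*} [Finite J] {κ : Ω → J} (hκ : ∀ c, MeasurableSet (κ ⁻¹' {c})) (X : LInf P)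
    (himp : ∀ W ∈ allocations n X, ∃ Y ∈ allocations n X, (∀ i, ρ i (Y i) ≤ ρ i (W i)) ∧
      ∀ i, Y i ∈ locallyLipschitzSet κ X) :
    ∃ Y : Fin n → LInf P, IsOptimalAllocation ρ X Y := by
  let j : Fin n := ⟨0, by omega⟩
  obtain ⟨Z, -, hZ⟩ := hcompat j (by simp only [j]; omega)
  set T := (fun W : Fin n → LInf P => ∑ i, ρ i (W i)) '' allocations n X with hT
  have hbdd : BddBelow T := bddBelow_aggregate_risk hZ X
  have hne : T.Nonempty := ⟨_, Pi.single j X, by simp [allocations], rfl⟩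
  set I := sInf T with hI
  obtain ⟨u, hu_anti, hu, huT⟩ := exists_seq_tendsto_sInf hne hbdd
  choose W hW hWu using huT
  choose Y hY hYρ hYlip using fun k => himp (W k) (hW k)
  set σ : ℕ → ℝ := fun k => ∑ i, ρ i (Y k i) with hσ
  have hσT : ∀ k, I ≤ σ k := fun k => csInf_le hbdd ⟨Y k, hY k, rfl⟩
  have hσu : ∀ k, σ k ≤ u k := fun k => by
    rw [← hWu k]
    exact Finset.sum_le_sum fun i _ => hYρ k i
  have hσI : Tendsto σ atTop (𝓝 I) := tendsto_of_tendsto_of_tendsto_of_le_of_le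
    tendsto_const_nhds hu hσT hσu
  -- rebalancing cash makes every component have risk zero
  let V : ℕ → Fin n → LInf P := fun k i => Y k i + Lp.const ∞ P (-ρ i (Y k i))
  have hVρ : ∀ k i, ρ i (V k i) = 0 := fun k i => by
    simp only [V]
    rw [(hρ i).cash_additive, add_neg_cancel]
  have hVlip : ∀ k i, V k i ∈ locallyLipschitzSet κ X := fun k i =>
    add_const_mem_locallyLipschitzSet (hYlip k i) _
  have hVsum : ∀ k, ∑ i, V k i = X + Lp.const ∞ P (-σ k) := fun k => by
    have : ∑ i, Y k i = X := hY k
    simp only [V]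
    rw [Finset.sum_add_distrib, this, ← map_sum, Finset.sum_neg_distrib]
  obtain ⟨R, hR⟩ := exists_norm_le_of_acceptable hcompat hκ hVlip
    (fun k i => (hVρ k i).le) (σ := fun k => -σ k) (S := max |I| |u 0|)
    (fun k => by
      rw [abs_neg]
      exact abs_le_max_abs_abs (hσT k) ((hσu k).trans (hu_anti (Nat.zero_le k)))) hVsum
  obtain ⟨K, hK, hKmem⟩ := exists_isCompact_locallyLipschitzSet hκ X R
  obtain ⟨L, -, φ, hφ, hL⟩ := (isCompact_univ_pi fun _ : Fin n => hK).tendsto_subseq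
    (x := V) fun k i _ => hKmem _ (hVlip k i) ((norm_le_pi_norm (V k) i).trans (hR k))
  have hLi := tendsto_pi_nhds.1 hL
  have hLρ : ∀ i, ρ i (L i) = 0 := fun i =>
    tendsto_nhds_unique (((hρ i).continuous.tendsto _).comp (hLi i))
      (by simp [Function.comp_def, hVρ])
  have hLsum : ∑ i, L i = X + Lp.const ∞ P (-I) := by
    refine tendsto_nhds_unique (tendsto_finsetSum Finset.univ fun i _ => hLi i) ?_
    have h1 : Tendsto (fun k => |(-σ (φ k)) - (-I)|) atTop (𝓝 0) := by
      have := (((hσI.comp hφ.tendsto_atTop).neg).sub_const (-I)).abs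
      simpa using this
    rw [tendsto_iff_norm_sub_tendsto_zero]
    refine squeeze_zero (fun _ => norm_nonneg _) (fun k => ?_) h1
    simp only [Function.comp_apply]
    rw [hVsum, add_sub_add_left_eq_sub, ← map_sub]
    exact norm_const_le _
  set O : Fin n → LInf P := fun i => L i + Lp.const ∞ P ((Pi.single j I : Fin n → ℝ) i) with hO
  have hOalloc : O ∈ allocations n X := by
    change ∑ i, O i = X
    rw [hO, Finset.sum_add_distrib, hLsum, ← map_sum, Finset.sum_pi_single']
    simp [add_assoc]
  have hOsum : ∑ i, ρ i (O i) = I := by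
    simp only [hO, (hρ _).cash_additive, hLρ, zero_add]
    simp
  refine ⟨O, hOalloc, le_antisymm (iInf₂_le O hOalloc) (le_iInf₂ fun W hW => ?_)⟩
  rw [hOsum]
  exact EReal.coe_le_coe_iff.2 (csInf_le hbdd ⟨W, hW, rfl⟩)

end Existence

end RiskSharing

theorem mainTheorem1 {Ω : Type*} [MeasurableSpace Ω] (P : Measure Ω) [IsProbabilityMeasure P]
    (hP : RiskSharing.IsAtomless P) (n : ℕ) (hn : 2 ≤ n)
    (Q : Fin n → Measure Ω) [∀ i, IsProbabilityMeasure (Q i)]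
    (hequiv : ∀ i, RiskSharing.EquivMeasure (Q i) P)
    (hsimple : ∀ i, RiskSharing.HasSimpleDensity P (Q i))
    (ρ : Fin n → RiskSharing.LInf P → ℝ)
    (hρ : ∀ i, RiskSharing.IsConsistent (Q i) (ρ i))
    (hadm : ∀ i : Fin n, (i : ℕ) + 1 < n → RiskSharing.IsAdmissible (ρ i))
    (hcompat : ∀ i : Fin n, (i : ℕ) + 1 < n → ∃ Z ∈ RiskSharing.compatibleSet (ρ i),
      (⨆ k, RiskSharing.conjugate (ρ k) (RiskSharing.toDual Z)) < ⊤)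
    (X : RiskSharing.LInf P) :
    ∃ Y : Fin n → RiskSharing.LInf P, RiskSharing.IsOptimalAllocation ρ X Y := by
  have hQ : ∀ i, Q i ≪ P := fun i => (hequiv i).1
  obtain ⟨J, hJ, κ, hκ, hw⟩ := RiskSharing.exists_partition_of_hasSimpleDensity hQ hsimple
  refine RiskSharing.exists_isOptimalAllocation hn (fun i => (hρ i).toIsMonetary) hcompat hκ X
    fun W hW => ?_
  have hWX : ∑ i, W i = X := hW
  obtain ⟨Y, hY, hdom, hlip⟩ := RiskSharing.exists_locallyLipschitz_improvement hQ hκ hw W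
  rw [hWX] at hY hlip
  exact ⟨Y, hY, fun i => (hρ i).consistent _ _ (hdom i), hlip⟩
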